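/- Let $q\ge 2$ and let $U=(u_{a,b})$ be a $q\times q$ row-stochastic matrix of full rank $q$ with strictly positive entries. For $n\ge 1$ let $\Sigma_{n,U}$ be the channel with input and output alphabet $\{1,\dots,q\}^n$ that first permutes the coordinates of the input $\mathbf x$ by a uniformly random permutation $\sigma\in S_n$ and then passes each coordinate independently through the memoryless channel $U$, i.e. with transition probability $$P_{n}(\mathbf y|\mathbf x)=\frac1{n!}\sum_{\sigma\in S_n}\ \prod_{i=1}^n u_{x_{\sigma^{-1}(i)},\,y_i}.$$ An $(n,L)$ identification (ID) code, $L\ge 2$, is a family $(Q_i,D_i)_{i=1}^{L}$, where each $Q_i$ is a probability distribution on $\{1,\dots,q\}^n$ (stochastic encoder) and each $D_i:\{1,\dots,q\}^n\to[0,1]$ gives the probability $D_i(\mathbf y)$ that the $i$-th decoder accepts $\mathbf y$ (stochastic decoder; the decoder is deterministic if $D_i$ takes values in $\{0,1\}$). Its error probability is $\lambda=\lambda_1+\lambda_2$ with $$\lambda_1=\max_{i}\sum_{\mathbf x,\mathbf y}Q_i(\mathbf x)P_n(\mathbf y|\mathbf x)(1-D_i(\mathbf y)),\qquad \lambda_2=\max_{i\ne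 j}\sum_{\mathbf x,\mathbf y}Q_i(\mathbf x)P_n(\mathbf y|\mathbf x)D_j(\mathbf y),$$ and its rate is $\frac{\log\log L}{\log n}$ (logarithms to base $2$). A real number $R$ is an achievable identification rate over $\Sigma_U=(\Sigma_{n,U})_{n\in\mathbb N}$ if there is a sequence of $(n_k,L_k)$ ID codes with error probabilities $\lambda^{(k)}$ such that $n_k\to\infty$, $\frac{\log\log L_k}{\log n_k}\to R$ and $\lambda^{(k)}\to 0$ as $k\to\infty$. The identification capacity of $\Sigma_U$ is the supremum of all achievable identification rates. Then the identification capacity of $\Sigma_U$ equals $\frac{q-1}{2}$, and the same holds if only ID codes with deterministic decoders are admitted. -/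

import Mathlib

open Filter Topology

noncomputable section

namespace NoisyPermutation

/-- Transition probability `P(z|x)` of the `n`-block permutation channel over `Fin q`: the
coordinates of the input `x` are reordered by a uniformly distributed permutation. -/
def permutationChannel (q n : ℕ) (x z : Fin n → Fin q) : ℝ :=
  (1 / (n.factorial : ℝ)) *
    ∑ σ : Equiv.Perm (Fin n), if ∀ i, z i = x (σ⁻¹ i) then (1 : ℝ) else 0

/-- Transition probability `U⁽ⁿ⁾(y|z)` of the `n`-fold memoryless extension of the discrete
memoryless channel with transition matrix `U`, where `U a b` is the probability of `b` given `a`. -/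
def memorylessExtension {q : ℕ} (U : Matrix (Fin q) (Fin q) ℝ) (n : ℕ)
    (z y : Fin n → Fin q) : ℝ :=
  ∏ i, U (z i) (y i)

/-- Transition probability `P(y|x)` of the `n`-block noisy permutation channel: the input is
first randomly permuted, and the result is passed through the memoryless channel. -/
def noisyPermutationChannel {q : ℕ} (U : Matrix (Fin q) (Fin q) ℝ) (n : ℕ)
    (x y : Fin n → Fin q) : ℝ :=
  ∑ z : Fin n → Fin q, permutationChannel q n x z * memorylessExtension U n z y

/-- An identification code with `L` messages, stochastic encoders and stochastic decoders, for
channels with finite input alphabet `A` and finite output alphabet `B`. Message `i` is encoded to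
`x` with probability `encode i x`; decoder `i` accepts the received symbol `y` with probability
`accept i y`, and rejects it with probability `1 - accept i y`. -/
structure IDCode (A B : Type*) [Fintype A] (L : ℕ) where
  encode : Fin L → A → ℝ
  encode_mem : ∀ i, encode i ∈ stdSimplex ℝ A
  accept : Fin L → B → ℝ
  accept_mem : ∀ i y, accept i y ∈ Set.Icc (0 : ℝ) 1

namespace IDCode

variable {A B : Type*} [Fintype A] [Fintype B] {L : ℕ}

/-- The decoders are deterministic: decoder `i` accepts exactly on the decoding region
`{y | accept i y = 1}`. -/
def HasDeterministicDecoders (C : IDCode A B L) : Prop :=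
  ∀ i y, C.accept i y = 0 ∨ C.accept i y = 1

/-- Probability that decoder `j` accepts when message `i` is sent over the channel `P`, where
`P x y` is the probability of `y` given `x`. -/
def falseAcceptance (P : A → B → ℝ) (C : IDCode A B L) (i j : Fin L) : ℝ :=
  ∑ x, ∑ y, C.encode i x * P x y * C.accept j y

/-- Probability that decoder `i` rejects when message `i` is sent over the channel `P`. -/
def missedDetection (P : A → B → ℝ) (C : IDCode A B L) (i : Fin L) : ℝ :=
  ∑ x, ∑ y, C.encode i x * P x y * (1 - C.accept i y)

/-- Type-I error probability: the maximum of the missed detection probabilities. -/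
def typeIError (P : A → B → ℝ) (C : IDCode A B L) : ℝ :=
  ⨆ i : Fin L, C.missedDetection P i

/-- Type-II error probability: the maximum, over pairs of distinct messages, of the probabilities
of false acceptance. -/
def typeIIError (P : A → B → ℝ) (C : IDCode A B L) : ℝ :=
  ⨆ p : {p : Fin L × Fin L // p.1 ≠ p.2}, C.falseAcceptance P p.1.1 p.1.2

/-- The probability of error of an identification code. -/
def error (P : A → B → ℝ) (C : IDCode A B L) : ℝ :=
  C.typeIError P + C.typeIIError P

end IDCode

/-- The rate `log log L / log n` (logarithms to base 2) of an identification code with `L`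
messages and blocklength `n`. -/
def idRate (n L : ℕ) : ℝ :=
  Real.logb 2 (Real.logb 2 (L : ℝ)) / Real.logb 2 (n : ℝ)

/-- `R` is an achievable identification rate over the noisy permutation channel (stochastic
decoders allowed). Codes have at least two messages, so that `log log L` is meaningful. -/
def IsAchievableIDRate {q : ℕ} (U : Matrix (Fin q) (Fin q) ℝ) (R : ℝ) : Prop :=
  ∃ (n L : ℕ → ℕ) (C : ∀ k, IDCode (Fin (n k) → Fin q) (Fin (n k) → Fin q) (L k)),
    (∀ k, 2 ≤ L k) ∧
    Tendsto n atTop atTop ∧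
    Tendsto (fun k => idRate (n k) (L k)) atTop (𝓝 R) ∧
    Tendsto (fun k => (C k).error (noisyPermutationChannel U (n k))) atTop (𝓝 0)

/-- `R` is an achievable identification rate over the noisy permutation channel by codes with
deterministic decoders (and stochastic encoders). -/
def IsAchievableIDRateDetDecoders {q : ℕ} (U : Matrix (Fin q) (Fin q) ℝ) (R : ℝ) : Prop :=
  ∃ (n L : ℕ → ℕ) (C : ∀ k, IDCode (Fin (n k) → Fin q) (Fin (n k) → Fin q) (L k)),
    (∀ k, (C k).HasDeterministicDecoders) ∧
    (∀ k, 2 ≤ L k) ∧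
    Tendsto n atTop atTop ∧
    Tendsto (fun k => idRate (n k) (L k)) atTop (𝓝 R) ∧
    Tendsto (fun k => (C k).error (noisyPermutationChannel U (n k))) atTop (𝓝 0)

/-- `c` is the identification capacity of the noisy permutation channel: the supremum of all
achievable identification rates. -/
def IsIDCapacity {q : ℕ} (U : Matrix (Fin q) (Fin q) ℝ) (c : ℝ) : Prop :=
  IsLUB {R : ℝ | IsAchievableIDRate U R} c

/-- `c` is the identification capacity of the noisy permutation channel when only codes with
deterministic decoders are admitted. -/
def IsIDCapacityDetDecoders {q : ℕ} (U : Matrix (Fin q) (Fin q) ℝ) (c : ℝ) : Prop :=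
  IsLUB {R : ℝ | IsAchievableIDRateDetDecoders U R} c

end NoisyPermutation

end

noncomputable section

namespace NoisyPermutation

/-! Write `q = d + 1`. Averaging a decoder over all orders of its argument turns the channel into
the memoryless channel `U` tested against permutation invariant functions
(`sum_noisyPermutationChannel_mul`), so only the letter counts of the input matter.

Converse: change one letter of the input into a letter `a` that then occurs `m` times. By invariance
the likelihood ratio may be averaged over all `m` occurrences of `a`. This average has variance
`O(1/m)`, with finite chi-square divergences because `U` is positive, so acceptance probabilities
move by `O(1/√m)` (`abs_memorylessExpectation_sub_update_le`). Some letter occurs at least `n / (d +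
1)` times, so rounding the other `d` counts to multiples of a small constant times `√n` is harmless
and leaves `O(n^(d/2))` labels. Messages whose label distributions agree after quantization cannot
be separated (`IDCode.card_le_of_label`), hence `log L = O(n^(d/2) log n)`.

Achievability: `U` is invertible, and `U⁻¹` gives unbiased estimates of the counts with variance
`O(n)`. A grid of counts with spacing slightly above `√n` is therefore decoded reliably
(`exists_transmissionCode`), with about `n^(d/2 - ε)` points. Functions with few pairwise agreements
turn `m * 2 ^ t` such points into `2 ^ m` identification messages with deterministic decoders
(`exists_idCode_of_transmissionCode`); `t` need only tend to infinity, so the loss in rate can be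
made arbitrarily small. -/

/-- Expected value of `f` at the output of the memoryless channel `U` with input `x`. -/
def memorylessExpectation {q n : ℕ} (U : Matrix (Fin q) (Fin q) ℝ) (x : Fin n → Fin q)
    (f : (Fin n → Fin q) → ℝ) : ℝ :=
  ∑ y, memorylessExtension U n x y * f y

/-- Number of occurrences of the letter `c` in the word `x`. -/
def letterCount {q n : ℕ} (x : Fin n → Fin q) (c : Fin q) : ℕ :=
  (Finset.univ.filter fun i => x i = c).card

/-- Functions of words that do not depend on the order of the letters. -/
def IsPermInvariant {q n : ℕ} (f : (Fin n → Fin q) → ℝ) : Prop :=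
  ∀ (σ : Equiv.Perm (Fin n)) (y : Fin n → Fin q), f (y ∘ σ) = f y

/-- Average of a function of words over all orders of the letters. -/
def permAverage {q n : ℕ} (f : (Fin n → Fin q) → ℝ) (y : Fin n → Fin q) : ℝ :=
  (1 / (n.factorial : ℝ)) * ∑ σ : Equiv.Perm (Fin n), f (y ∘ σ)

/-! ### Moments under the memoryless channel, and symmetrization. -/

section Expectation

variable {q n : ℕ} {U : Matrix (Fin q) (Fin q) ℝ}

lemma memorylessExtension_nonneg (hU : ∀ a b, 0 ≤ U a b) (x y : Fin n → Fin q) :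
    0 ≤ memorylessExtension U n x y :=
  Finset.prod_nonneg fun _ _ => hU _ _

lemma memorylessExpectation_prod (x : Fin n → Fin q) (h : Fin n → Fin q → ℝ) :
    memorylessExpectation U x (fun y => ∏ i, h i (y i)) = ∏ i, ∑ c, U (x i) c * h i c := by
  simp only [memorylessExpectation, memorylessExtension, ← Finset.prod_mul_distrib,
    Finset.prod_univ_sum, Fintype.piFinset_univ]

lemma memorylessExpectation_add (x : Fin n → Fin q) (f g : (Fin n → Fin q) → ℝ) :
    memorylessExpectation U x (fun y => f y + g y) =
      memorylessExpectation U x f + memorylessExpectation U x g := by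
  simp [memorylessExpectation, mul_add, Finset.sum_add_distrib]

lemma memorylessExpectation_sub (x : Fin n → Fin q) (f g : (Fin n → Fin q) → ℝ) :
    memorylessExpectation U x (fun y => f y - g y) =
      memorylessExpectation U x f - memorylessExpectation U x g := by
  simp [memorylessExpectation, mul_sub, Finset.sum_sub_distrib]

lemma memorylessExpectation_const_mul (x : Fin n → Fin q) (a : ℝ) (f : (Fin n → Fin q) → ℝ) :
    memorylessExpectation U x (fun y => a * f y) = a * memorylessExpectation U x f := by
  simp [memorylessExpectation, Finset.mul_sum, mul_left_comm]

lemma memorylessExpectation_sum {ι : Type*} (s : Finset ι) (x : Fin n → Fin q)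
    (f : ι → (Fin n → Fin q) → ℝ) :
    memorylessExpectation U x (fun y => ∑ k ∈ s, f k y) =
      ∑ k ∈ s, memorylessExpectation U x (f k) := by
  simp only [memorylessExpectation, Finset.mul_sum]
  exact Finset.sum_comm

lemma memorylessExpectation_mono (hU : ∀ a b, 0 ≤ U a b) (x : Fin n → Fin q)
    {f g : (Fin n → Fin q) → ℝ} (h : ∀ y, f y ≤ g y) :
    memorylessExpectation U x f ≤ memorylessExpectation U x g :=
  Finset.sum_le_sum fun y _ => mul_le_mul_of_nonneg_left (h y) (memorylessExtension_nonneg hU x y)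

lemma memorylessExpectation_one (hU1 : ∀ a, ∑ b, U a b = 1) (x : Fin n → Fin q) :
    memorylessExpectation U x (fun _ => 1) = 1 := by
  have := memorylessExpectation_prod (U := U) x (fun _ _ => 1)
  simpa [hU1] using this

lemma sq_memorylessExpectation_le (hU : ∀ a b, 0 ≤ U a b) (hU1 : ∀ a, ∑ b, U a b = 1)
    (x : Fin n → Fin q) (f : (Fin n → Fin q) → ℝ) :
    memorylessExpectation U x f ^ 2 ≤ memorylessExpectation U x (fun y => f y ^ 2) := by
  set e := memorylessExpectation U x f with he
  have h0 : memorylessExpectation U x (fun _ => 0) ≤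
      memorylessExpectation U x (fun y => (f y ^ 2 - (2 * e) * f y) + e ^ 2 * 1) :=
    memorylessExpectation_mono hU x fun y => by nlinarith [sq_nonneg (f y - e)]
  rw [memorylessExpectation_add, memorylessExpectation_sub, memorylessExpectation_const_mul,
    memorylessExpectation_const_mul, memorylessExpectation_one hU1, ← he] at h0
  have h1 : memorylessExpectation U x (fun _ => 0) = 0 := by simp [memorylessExpectation]
  nlinarith

lemma memorylessExpectation_coord_mul_coord (hU1 : ∀ a, ∑ b, U a b = 1) (x : Fin n → Fin q)
    (φ : Fin n → Fin q → ℝ) (hφ : ∀ i, ∑ c, U (x i) c * φ i c = 0) (i j : Fin n) :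
    memorylessExpectation U x (fun y => φ i (y i) * φ j (y j)) =
      if i = j then ∑ c, U (x i) c * φ i c ^ 2 else 0 := by
  -- Both factors are written as products over all coordinates, trivial away from `i` and `j`, so
  -- that the case `i = j` needs no separate expansion.
  have h := memorylessExpectation_prod (U := U) x
    (fun k c => (if k = i then φ i c else 1) * (if k = j then φ j c else 1))
  simp only [Finset.prod_mul_distrib, Finset.prod_ite_eq', Finset.mem_univ, if_true] at h
  rw [h]
  split_ifs with hij
  · subst hij
    rw [Finset.prod_eq_single i]
    · simp [sq]
    · intro k _ hk
      simp [hk, hU1]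
    · simp
  · apply Finset.prod_eq_zero (Finset.mem_univ i)
    simpa [hij] using hφ i

/-- The second moment of a sum of independent centred terms is the sum of their second moments. -/
lemma memorylessExpectation_sum_sq (hU1 : ∀ a, ∑ b, U a b = 1) (x : Fin n → Fin q)
    (φ : Fin n → Fin q → ℝ) (hφ : ∀ i, ∑ c, U (x i) c * φ i c = 0) :
    memorylessExpectation U x (fun y => (∑ i, φ i (y i)) ^ 2) =
      ∑ i, ∑ c, U (x i) c * φ i c ^ 2 := by
  simp only [sq (∑ i, φ i _), Finset.sum_mul_sum, memorylessExpectation_sum,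
    memorylessExpectation_coord_mul_coord hU1 x φ hφ]
  simp

lemma memorylessExpectation_comp_perm (x : Fin n → Fin q) (σ : Equiv.Perm (Fin n))
    (f : (Fin n → Fin q) → ℝ) :
    memorylessExpectation U (x ∘ σ) f = memorylessExpectation U x (fun y => f (y ∘ σ)) := by
  simp only [memorylessExpectation, memorylessExtension]
  refine (Fintype.sum_equiv (Equiv.arrowCongr σ.symm (Equiv.refl (Fin q))) _ _ fun y => ?_).symm
  congr 1
  exact (Equiv.prod_comp σ fun i => U (x i) (y i)).symm

lemma IsPermInvariant.memorylessExpectation_comp {f : (Fin n → Fin q) → ℝ}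
    (hf : IsPermInvariant f) (x : Fin n → Fin q) (σ : Equiv.Perm (Fin n)) :
    memorylessExpectation U (x ∘ σ) f = memorylessExpectation U x f := by
  rw [memorylessExpectation_comp_perm]
  simp only [hf σ]

lemma permAverage_isPermInvariant (f : (Fin n → Fin q) → ℝ) : IsPermInvariant (permAverage f) := by
  intro τ y
  simp only [permAverage]
  congr 1
  exact Fintype.sum_equiv (Equiv.mulLeft τ) _ _ fun σ => rfl

lemma IsPermInvariant.permAverage_eq {f : (Fin n → Fin q) → ℝ} (hf : IsPermInvariant f) :
    permAverage f = f := by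
  ext y
  have : (n.factorial : ℝ) ≠ 0 := by positivity
  simp [permAverage, hf _ y, Fintype.card_perm, this]

lemma permAverage_mem_Icc {f : (Fin n → Fin q) → ℝ} (hf : ∀ y, f y ∈ Set.Icc (0 : ℝ) 1)
    (y : Fin n → Fin q) : permAverage f y ∈ Set.Icc (0 : ℝ) 1 := by
  have hn : (0 : ℝ) < n.factorial := by positivity
  refine ⟨mul_nonneg (by positivity) (Finset.sum_nonneg fun σ _ => (hf _).1), ?_⟩
  have h : ∑ σ : Equiv.Perm (Fin n), f (y ∘ σ) ≤ ∑ _σ : Equiv.Perm (Fin n), (1 : ℝ) :=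
    Finset.sum_le_sum fun σ _ => (hf _).2
  simp only [Finset.sum_const, Finset.card_univ, Fintype.card_perm, Fintype.card_fin,
    nsmul_eq_mul, mul_one] at h
  rw [permAverage, one_div, inv_mul_le_iff₀ hn, mul_one]
  exact h

/-- Averages over the output of the noisy permutation channel are averages over the output of the
memoryless channel, after symmetrization. -/
lemma sum_noisyPermutationChannel_mul (x : Fin n → Fin q) (f : (Fin n → Fin q) → ℝ) :
    ∑ y, noisyPermutationChannel U n x y * f y =
      memorylessExpectation U x (permAverage f) := by
  have hz : ∀ (σ : Equiv.Perm (Fin n)) (z : Fin n → Fin q),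
      (∀ i, z i = x (σ⁻¹ i)) ↔ z = x ∘ ⇑(σ⁻¹) := fun σ z => by
    simp [funext_iff]
  have h1 : ∀ y, noisyPermutationChannel U n x y =
      (1 / (n.factorial : ℝ)) * ∑ σ : Equiv.Perm (Fin n),
        memorylessExtension U n (x ∘ ⇑(σ⁻¹)) y := by
    intro y
    simp only [noisyPermutationChannel, permutationChannel, mul_assoc, ← Finset.mul_sum,
      Finset.sum_mul, hz]
    rw [Finset.sum_comm]
    simp
  have h2 : ∀ σ : Equiv.Perm (Fin n), ∑ y, memorylessExtension U n (x ∘ ⇑(σ⁻¹)) y * f y =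
      memorylessExpectation U x (fun y => f (y ∘ ⇑(σ⁻¹))) := fun σ =>
    memorylessExpectation_comp_perm x σ⁻¹ f
  simp only [h1, mul_assoc, ← Finset.mul_sum, Finset.sum_mul]
  rw [Finset.sum_comm]
  simp only [h2]
  rw [← memorylessExpectation_sum, ← memorylessExpectation_const_mul]
  congr 1
  ext y
  rw [permAverage]
  congr 1
  exact Equiv.sum_comp (Equiv.inv (Equiv.Perm (Fin n))) (fun σ => f (y ∘ σ))

lemma noisyPermutationChannel_nonneg (hU : ∀ a b, 0 ≤ U a b) (x y : Fin n → Fin q) :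
    0 ≤ noisyPermutationChannel U n x y := by
  refine Finset.sum_nonneg fun z _ => mul_nonneg (mul_nonneg (by positivity) ?_)
    (memorylessExtension_nonneg hU z y)
  exact Finset.sum_nonneg fun σ _ => by split_ifs <;> norm_num

lemma sum_noisyPermutationChannel (hU1 : ∀ a, ∑ b, U a b = 1) (x : Fin n → Fin q) :
    ∑ y, noisyPermutationChannel U n x y = 1 := by
  have h := sum_noisyPermutationChannel_mul (U := U) x (fun _ => 1)
  rw [IsPermInvariant.permAverage_eq (fun _ _ => rfl), memorylessExpectation_one hU1] at h
  simpa using h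

end Expectation

/-! ### Types of words. -/

section LetterCounts

variable {q n : ℕ}

lemma sum_letterCount (x : Fin n → Fin q) : ∑ c, letterCount x c = n := by
  have h := Finset.card_eq_sum_card_fiberwise (f := x) (s := Finset.univ) (t := Finset.univ)
    (fun _ _ => Finset.mem_coe.2 (Finset.mem_univ _))
  simpa [letterCount] using h.symm

lemma letterCount_update (x : Fin n → Fin q) (j : Fin n) (a c : Fin q) :
    letterCount (Function.update x j a) c + (if x j = c then 1 else 0) =
      letterCount x c + (if a = c then 1 else 0) := by
  simp only [letterCount, Finset.card_filter]
  rw [← Finset.add_sum_erase _ _ (Finset.mem_univ j),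
    ← Finset.add_sum_erase (a := j) _ (fun i => if x i = c then 1 else 0) (Finset.mem_univ j)]
  have : ∑ i ∈ Finset.univ.erase j, (if Function.update x j a i = c then 1 else 0) =
      ∑ i ∈ Finset.univ.erase j, (if x i = c then 1 else 0) :=
    Finset.sum_congr rfl fun i hi => by
      rw [Function.update_of_ne (Finset.ne_of_mem_erase hi)]
  rw [this, Function.update_self]
  ring

/-- Equal counts give bijections between the fibres of the two words, which glue to a permutation of
the positions. -/
lemma exists_perm_of_letterCount_eq {x z : Fin n → Fin q}
    (h : ∀ c, letterCount x c = letterCount z c) : ∃ σ : Equiv.Perm (Fin n), x = z ∘ σ := by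
  have he : ∀ c, Nonempty ({i // x i = c} ≃ {i // z i = c}) := fun c => by
    rw [← Fintype.card_eq, Fintype.card_subtype, Fintype.card_subtype]
    exact h c
  let e := fun c => (he c).some
  let σ : Equiv.Perm (Fin n) :=
    (Equiv.sigmaFiberEquiv x).symm.trans
      ((Equiv.sigmaCongrRight e).trans (Equiv.sigmaFiberEquiv z))
  refine ⟨σ, funext fun i => ?_⟩
  exact ((e (x i)) ⟨i, rfl⟩).2.symm

/-- Words with arbitrary prescribed letter counts exist. -/
lemma exists_letterCount_eq (k : Fin q → ℕ) (hk : ∑ c, k c = n) :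
    ∃ x : Fin n → Fin q, ∀ c, letterCount x c = k c := by
  have hcard : Fintype.card (Σ c, Fin (k c)) = n := by simp [hk]
  let e := (Fintype.equivFinOfCardEq hcard).symm
  refine ⟨fun i => (e i).1, fun c => ?_⟩
  have h1 : letterCount (fun i => (e i).1) c = Fintype.card {i // (e i).1 = c} := by
    rw [Fintype.card_subtype]; rfl
  rw [h1, Fintype.card_congr (e.subtypeEquiv (q := fun s => s.1 = c) fun i => Iff.rfl),
    Fintype.card_congr (Equiv.sigmaSubtype c), Fintype.card_fin]

lemma exists_le_mul_letterCount (hq : 0 < q) (x : Fin n → Fin q) :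
    ∃ a, n ≤ q * letterCount x a := by
  have : Nonempty (Fin q) := ⟨⟨0, hq⟩⟩
  obtain ⟨a, -, ha⟩ := Finset.exists_max_image Finset.univ (letterCount x) Finset.univ_nonempty
  refine ⟨a, ?_⟩
  calc n = ∑ c, letterCount x c := (sum_letterCount x).symm
    _ ≤ ∑ _c : Fin q, letterCount x a := Finset.sum_le_sum ha
    _ = q * letterCount x a := by simp

end LetterCounts

/-! ### Stability of invariant expectations under letter replacement. -/

section Smoothing

variable {q n : ℕ} {U : Matrix (Fin q) (Fin q) ℝ}

/-- Change of measure at the single coordinate `j`; positivity of `U` makes the likelihood ratio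
well defined. -/
lemma memorylessExpectation_update (hU : ∀ a b, 0 < U a b) (x : Fin n → Fin q) (j : Fin n)
    (a : Fin q) (f : (Fin n → Fin q) → ℝ) :
    memorylessExpectation U x f = memorylessExpectation U (Function.update x j a)
      (fun y => f y * (U (x j) (y j) / U a (y j))) := by
  refine Finset.sum_congr rfl fun y _ => ?_
  rw [memorylessExtension, memorylessExtension, ← Finset.mul_prod_erase _ _ (Finset.mem_univ j),
    ← Finset.mul_prod_erase (a := j) _ (fun i => U (Function.update x j a i) (y i))
      (Finset.mem_univ j)]
  have : ∏ i ∈ Finset.univ.erase j, U (Function.update x j a i) (y i) =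
      ∏ i ∈ Finset.univ.erase j, U (x i) (y i) :=
    Finset.prod_congr rfl fun i hi => by
      rw [Function.update_of_ne (Finset.ne_of_mem_erase hi)]
  rw [this, Function.update_self]
  have := (hU a (y j)).ne'
  field_simp

/-- The sum of all chi-square divergences between rows of a channel matrix. -/
def totalChiSq (U : Matrix (Fin q) (Fin q) ℝ) : ℝ :=
  ∑ a, ∑ b, ∑ c, U a c * (U b c / U a c - 1) ^ 2

lemma chiSq_le_totalChiSq (hU : ∀ a b, 0 < U a b) (a b : Fin q) :
    ∑ c, U a c * (U b c / U a c - 1) ^ 2 ≤ totalChiSq U := by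
  have h0 : ∀ a b, 0 ≤ ∑ c, U a c * (U b c / U a c - 1) ^ 2 := fun a b =>
    Finset.sum_nonneg fun c _ => mul_nonneg (hU a c).le (sq_nonneg _)
  refine le_trans (Finset.single_le_sum (f := fun b => ∑ c, U a c * (U b c / U a c - 1) ^ 2)
    (fun b _ => h0 a b) (Finset.mem_univ b)) ?_
  exact Finset.single_le_sum (f := fun a => ∑ b, ∑ c, U a c * (U b c / U a c - 1) ^ 2)
    (fun a _ => Finset.sum_nonneg fun b _ => h0 a b) (Finset.mem_univ a)

/-- Replacing one letter by a letter `a` that occurs often hardly changes the expected value of a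
permutation invariant function: the likelihood ratio is an average over all occurrences of `a`. -/
lemma abs_memorylessExpectation_sub_update_le (hU : ∀ a b, 0 < U a b)
    (hU1 : ∀ a, ∑ b, U a b = 1) {f : (Fin n → Fin q) → ℝ} (hf : IsPermInvariant f)
    (hf1 : ∀ y, f y ∈ Set.Icc (0 : ℝ) 1) (x : Fin n → Fin q) (j : Fin n) (a : Fin q) {μ : ℝ}
    (hμ : 0 < μ) (hx : μ ≤ letterCount (Function.update x j a) a) :
    |memorylessExpectation U x f - memorylessExpectation U (Function.update x j a) f| ≤
      √(totalChiSq U / μ) := by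
  set x' := Function.update x j a with hx'
  have hU0 : ∀ a b, 0 ≤ U a b := fun a b => (hU a b).le
  have hj : x' j = a := by simp [hx']
  set w : Fin q → ℝ := fun c => U (x j) c / U a c with hw
  set φ : Fin n → Fin q → ℝ := fun i c => if x' i = a then w c - 1 else 0 with hφ
  -- Positions `i` and `j` of `x'` both carry `a`, so swapping them fixes `x'` and `f` and moves the
  -- likelihood ratio from `j` to `i`.
  have hsym : ∀ i, x' i = a → memorylessExpectation U x' (fun y => f y * w (y i)) =
      memorylessExpectation U x f := by
    intro i hi
    rw [memorylessExpectation_update hU x j a f, ← hx']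
    have hs : x' ∘ Equiv.swap i j = x' := by
      funext k
      by_cases h1 : k = i
      · subst h1; simp [hi, hj]
      by_cases h2 : k = j
      · subst h2; simp [hi, hj]
      simp [Equiv.swap_apply_of_ne_of_ne h1 h2]
    conv_lhs => rw [← hs, memorylessExpectation_comp_perm]
    simp [hf (Equiv.swap i j), hw]
  have hcard : (letterCount x' a : ℝ) =
      ∑ i, (if x' i = a then (1 : ℝ) else 0) := by
    simp [letterCount]
  -- Summing over all occurrences of `a` replaces one likelihood ratio of constant variance by an
  -- average of independent ones.
  have hmain : (letterCount x' a : ℝ) *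
      (memorylessExpectation U x f - memorylessExpectation U x' f) =
      memorylessExpectation U x' (fun y => f y * ∑ i, φ i (y i)) := by
    simp only [Finset.mul_sum]
    rw [memorylessExpectation_sum, hcard, Finset.sum_mul]
    refine Finset.sum_congr rfl fun i _ => ?_
    by_cases hi : x' i = a
    · simp only [hi, if_true, one_mul, hφ, mul_sub, mul_one]
      rw [memorylessExpectation_sub, hsym i hi]
    · simp [hi, hφ, memorylessExpectation]
  have hφ0 : ∀ i, ∑ c, U (x' i) c * φ i c = 0 := by
    intro i
    by_cases hi : x' i = a
    · have : ∀ c, U a c * (w c - 1) = U (x j) c - U a c := fun c => by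
        have := (hU a c).ne'
        simp only [hw]
        field_simp
      simp [hφ, hi, this, hU1]
    · simp [hφ, hi]
  have hvar : memorylessExpectation U x' (fun y => (∑ i, φ i (y i)) ^ 2) ≤
      letterCount x' a * totalChiSq U := by
    rw [memorylessExpectation_sum_sq hU1 x' φ hφ0, hcard, Finset.sum_mul]
    refine Finset.sum_le_sum fun i _ => ?_
    by_cases hi : x' i = a
    · simpa [hφ, hi, hw] using chiSq_le_totalChiSq hU a (x j)
    · simp [hφ, hi]
  have hcs := sq_memorylessExpectation_le hU0 hU1 x' (fun y => f y * ∑ i, φ i (y i))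
  have hmono : memorylessExpectation U x' (fun y => (f y * ∑ i, φ i (y i)) ^ 2) ≤
      memorylessExpectation U x' (fun y => (∑ i, φ i (y i)) ^ 2) := by
    refine memorylessExpectation_mono hU0 x' fun y => ?_
    rw [mul_pow]
    exact mul_le_of_le_one_left (sq_nonneg _) (pow_le_one₀ (hf1 y).1 (hf1 y).2)
  rw [← hmain, mul_pow] at hcs
  set m := (letterCount x' a : ℝ) with hm
  have hmpos : 0 < m := hμ.trans_le hx
  apply Real.abs_le_sqrt
  rw [le_div_iff₀ hμ]
  set D := (memorylessExpectation U x f - memorylessExpectation U x' f) ^ 2 with hD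
  have hD0 : 0 ≤ D := sq_nonneg _
  -- The second-moment bounds give `m² D ≤ m χ`; one factor `m` cancels, and `μ ≤ m` finishes.
  have h1 : m * (m * D) ≤ m * totalChiSq U := by nlinarith
  have h2 := le_of_mul_le_mul_left h1 hmpos
  nlinarith

/-- Repeatedly replacing letters by a frequent letter `a` reduces the numbers of the other letters
to any prescribed smaller values. -/
lemma exists_letterCount_eq_and_abs_sub_le (hU : ∀ a b, 0 < U a b)
    (hU1 : ∀ a, ∑ b, U a b = 1) {f : (Fin n → Fin q) → ℝ} (hf : IsPermInvariant f)
    (hf1 : ∀ y, f y ∈ Set.Icc (0 : ℝ) 1) (a : Fin q) (t : Fin q → ℕ) {μ : ℝ} (hμ : 0 < μ)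
    (k : ℕ) (x : Fin n → Fin q) (hx : μ ≤ letterCount x a)
    (ht : ∀ b, b ≠ a → t b ≤ letterCount x b)
    (hk : ∑ b ∈ Finset.univ.erase a, letterCount x b = ∑ b ∈ Finset.univ.erase a, t b + k) :
    ∃ z : Fin n → Fin q, (∀ b, b ≠ a → letterCount z b = t b) ∧
      |memorylessExpectation U x f - memorylessExpectation U z f| ≤
        k * √(totalChiSq U / μ) := by
  induction k generalizing x with
  | zero =>
    refine ⟨x, fun b hb => ?_, by simp⟩
    have := (Finset.sum_eq_sum_iff_of_le (s := Finset.univ.erase a) (f := t)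
      (g := letterCount x) fun b hb => ht b (Finset.ne_of_mem_erase hb)).1 (by omega)
    exact (this b (Finset.mem_erase.2 ⟨hb, Finset.mem_univ b⟩)).symm
  | succ k ih =>
    obtain ⟨b, hb, hlt⟩ : ∃ b ∈ Finset.univ.erase a, t b < letterCount x b :=
      Finset.exists_lt_of_sum_lt (by omega)
    have hba : b ≠ a := Finset.ne_of_mem_erase hb
    obtain ⟨j, hj⟩ : ∃ j, x j = b := by
      have : (Finset.univ.filter fun i => x i = b).Nonempty := by
        rw [← Finset.card_pos]
        exact (Nat.zero_le _).trans_lt hlt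
      obtain ⟨j, hj⟩ := this
      exact ⟨j, (Finset.mem_filter.1 hj).2⟩
    have hcount := letterCount_update x j a
    have hca := hcount a
    simp only [hj, if_true, hba, if_false] at hca
    have hother : ∀ c, c ≠ a → letterCount (Function.update x j a) c +
        (if c = b then 1 else 0) = letterCount x c := by
      intro c hc
      have := hcount c
      simpa [hj, hc.symm, eq_comm (a := b)] using this
    -- The count of `a` only grows along the replacements, so the same `μ` serves at every step.
    have hxa : μ ≤ letterCount (Function.update x j a) a := by
      refine hx.trans ?_
      exact_mod_cast (by omega : letterCount x a ≤ letterCount (Function.update x j a) a)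
    obtain ⟨z, hz, hzE⟩ := ih (Function.update x j a) hxa (fun c hc => by
        have h1 := hother c hc
        have h2 := ht c hc
        split_ifs at h1 with h
        · subst h; omega
        · omega) (by
        have : ∑ c ∈ Finset.univ.erase a, letterCount x c =
            ∑ c ∈ Finset.univ.erase a, (letterCount (Function.update x j a) c +
              (if c = b then 1 else 0)) :=
          Finset.sum_congr rfl fun c hc => (hother c (Finset.ne_of_mem_erase hc)).symm
        rw [Finset.sum_add_distrib, Finset.sum_ite_eq', if_pos hb] at this
        omega)
    refine ⟨z, hz, (abs_sub_le _ (memorylessExpectation U (Function.update x j a) f) _).trans ?_⟩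
    have := abs_memorylessExpectation_sub_update_le hU hU1 hf hf1 x j a hμ hxa
    push_cast
    linarith

end Smoothing

/-! ### Labelling inputs by rounded types. -/

section Labels

variable {d n : ℕ} {U : Matrix (Fin (d + 1)) (Fin (d + 1)) ℝ}

/-- A letter of maximal frequency. -/
def dominantLetter (x : Fin n → Fin (d + 1)) : Fin (d + 1) :=
  (exists_le_mul_letterCount d.succ_pos x).choose

lemma le_mul_letterCount_dominantLetter (x : Fin n → Fin (d + 1)) :
    n ≤ (d + 1) * letterCount x (dominantLetter x) :=
  (exists_le_mul_letterCount d.succ_pos x).choose_spec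

lemma letterCount_le (x : Fin n → Fin (d + 1)) (c : Fin (d + 1)) : letterCount x c ≤ n :=
  (Finset.card_le_univ _).trans (by simp)

/-- The type of a word, rounded down to multiples of `s`, apart from the count of the most
frequent letter. -/
def roundedType (s : ℕ) (x : Fin n → Fin (d + 1)) : Fin (d + 1) × (Fin d → Fin (n / s + 1)) :=
  (dominantLetter x, fun i => ⟨letterCount x ((dominantLetter x).succAbove i) / s,
    Nat.lt_succ_of_le (Nat.div_le_div_right (letterCount_le x _))⟩)

/-- Both words are moved to a common rounded type by turning at most `d * s` letters into the
dominant one, each at cost `√(χ / μ)` with `μ = n / (d + 1)`; the factor 2 counts the two words. -/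
lemma abs_sub_le_of_roundedType_eq (hU : ∀ a b, 0 < U a b)
    (hU1 : ∀ a, ∑ b, U a b = 1) {f : (Fin n → Fin (d + 1)) → ℝ} (hf : IsPermInvariant f)
    (hf1 : ∀ y, f y ∈ Set.Icc (0 : ℝ) 1) (hn : 0 < n) {s : ℕ} (hs : 0 < s)
    {x x' : Fin n → Fin (d + 1)} (h : roundedType s x = roundedType s x') :
    |memorylessExpectation U x f - memorylessExpectation U x' f| ≤
      2 * (d * s * √(totalChiSq U * (d + 1) / n)) := by
  obtain ⟨a, ha⟩ : ∃ a, dominantLetter x = a := ⟨_, rfl⟩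
  have ha' : dominantLetter x' = a := by rw [← ha]; exact (congrArg Prod.fst h).symm
  have hlab : ∀ b, b ≠ a → letterCount x b / s = letterCount x' b / s := by
    intro b hb
    obtain ⟨i, hi⟩ := Fin.exists_succAbove_eq hb
    have h2 := congrArg Fin.val (congrFun (congrArg Prod.snd h) i)
    simpa [roundedType, ha, ha', hi] using h2
  have hμ : (0 : ℝ) < n / (d + 1) := by positivity
  have key : ∀ v : Fin n → Fin (d + 1), dominantLetter v = a →
      ∃ z : Fin n → Fin (d + 1), (∀ b, b ≠ a → letterCount z b = s * (letterCount v b / s)) ∧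
      |memorylessExpectation U v f - memorylessExpectation U z f| ≤
        d * s * √(totalChiSq U * (d + 1) / n) := by
    intro v hv
    have hva := le_mul_letterCount_dominantLetter v
    rw [hv] at hva
    obtain ⟨z, hz, hzE⟩ := exists_letterCount_eq_and_abs_sub_le hU hU1 hf hf1 a
      (fun b => s * (letterCount v b / s)) hμ (∑ b ∈ Finset.univ.erase a, letterCount v b % s) v
      (by
        rw [div_le_iff₀ (by positivity), mul_comm]
        exact_mod_cast hva)
      (fun b _ => Nat.mul_div_le _ _)
      (by
        rw [← Finset.sum_add_distrib]
        exact Finset.sum_congr rfl fun b _ => (Nat.div_add_mod _ _).symm)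
    refine ⟨z, hz, hzE.trans ?_⟩
    rw [div_div_eq_mul_div]
    refine mul_le_mul_of_nonneg_right ?_ (Real.sqrt_nonneg _)
    have : ∑ b ∈ Finset.univ.erase a, letterCount v b % s ≤ d * s := by
      refine (Finset.sum_le_card_nsmul _ _ s fun b _ => (Nat.mod_lt _ hs).le).trans ?_
      simp
    exact_mod_cast this
  obtain ⟨z, hz, hzE⟩ := key x ha
  obtain ⟨z', hz', hzE'⟩ := key x' ha'
  have hne : ∀ b, b ≠ a → letterCount z b = letterCount z' b := fun b hb => by
    rw [hz b hb, hz' b hb, hlab b hb]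
  -- The count of the dominant letter is forced, since all counts sum to `n`.
  have hall : ∀ b, letterCount z b = letterCount z' b := by
    intro b
    by_cases hb : b = a
    · subst hb
      have h1 := sum_letterCount z
      have h2 := sum_letterCount z'
      rw [← Finset.add_sum_erase _ _ (Finset.mem_univ b)] at h1 h2
      have h3 : ∑ c ∈ Finset.univ.erase b, letterCount z c =
          ∑ c ∈ Finset.univ.erase b, letterCount z' c :=
        Finset.sum_congr rfl fun c hc => hne c (Finset.ne_of_mem_erase hc)
      omega
    · exact hne b hb
  obtain ⟨σ, hσ⟩ := exists_perm_of_letterCount_eq hall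
  have hzz : memorylessExpectation U z f = memorylessExpectation U z' f := by
    rw [hσ, hf.memorylessExpectation_comp]
  rw [abs_le] at hzE hzE' ⊢
  constructor <;> linarith [hzE.1, hzE.2, hzE'.1, hzE'.2]

end Labels

/-! ### Counting messages through quantized label distributions. -/

namespace IDCode

variable {A B : Type*} [Fintype A] [Fintype B] {L : ℕ}

lemma missedDetection_le_typeIError (P : A → B → ℝ) (C : IDCode A B L) (i : Fin L) :
    C.missedDetection P i ≤ C.typeIError P :=
  le_ciSup (f := fun i => C.missedDetection P i) (Set.finite_range _).bddAbove i

lemma falseAcceptance_le_typeIIError (P : A → B → ℝ) (C : IDCode A B L) {i j : Fin L}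
    (h : i ≠ j) : C.falseAcceptance P i j ≤ C.typeIIError P :=
  le_ciSup (f := fun p : {p : Fin L × Fin L // p.1 ≠ p.2} => C.falseAcceptance P p.1.1 p.1.2)
    (Set.finite_range _).bddAbove ⟨(i, j), h⟩

lemma falseAcceptance_eq (P : A → B → ℝ) (C : IDCode A B L) (i j : Fin L) :
    C.falseAcceptance P i j = ∑ x, C.encode i x * ∑ y, P x y * C.accept j y := by
  simp only [falseAcceptance, Finset.mul_sum, mul_assoc]

lemma missedDetection_eq {P : A → B → ℝ} (hP1 : ∀ x, ∑ y, P x y = 1) (C : IDCode A B L)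
    (i : Fin L) : C.missedDetection P i = 1 - C.falseAcceptance P i i := by
  have h : ∑ x, ∑ y, C.encode i x * P x y = 1 := by
    simp [← Finset.mul_sum, hP1, (C.encode_mem i).2]
  rw [← h]
  simp [missedDetection, falseAcceptance, mul_sub, Finset.sum_sub_distrib]

/-- If the acceptance probabilities depend, up to a small error, only on a label of the channel
input, then the number of messages is at most the number of quantized distributions on labels. -/
lemma card_le_of_label {P : A → B → ℝ} (hP : ∀ x y, 0 ≤ P x y) (hP1 : ∀ x, ∑ y, P x y = 1)
    (C : IDCode A B L) {Λ : Type*} [Fintype Λ] (ℓ : A → Λ)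
    (hℓ : ∀ j x x', ℓ x = ℓ x' →
      |∑ y, P x y * C.accept j y - ∑ y, P x' y * C.accept j y| ≤ 1 / 16)
    (herr : C.error P ≤ 1 / 4) :
    L ≤ (2 * Fintype.card Λ + 1) ^ Fintype.card Λ := by
  classical
  set N := Fintype.card Λ with hN
  set p : Fin L → Λ → ℝ := fun i l => ∑ x, if ℓ x = l then C.encode i x else 0 with hp
  have hp0 : ∀ i l, 0 ≤ p i l := fun i l => Finset.sum_nonneg fun x _ => by
    split_ifs
    · exact (C.encode_mem i).1 x
    · exact le_rfl
  have hp1 : ∀ i l, p i l ≤ 1 := fun i l => by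
    rw [← (C.encode_mem i).2]
    refine Finset.sum_le_sum fun x _ => ?_
    split_ifs
    · exact le_rfl
    · exact (C.encode_mem i).1 x
  -- Label probabilities are rounded to multiples of `1 / (2N)`, so that errors over `N` labels add
  -- up to at most `1/2`.
  let Φ : Fin L → Λ → Fin (2 * N + 1) := fun i l => ⟨⌊2 * N * p i l⌋₊, by
    refine Nat.lt_succ_of_le (Nat.floor_le_of_le ?_)
    push_cast
    exact mul_le_of_le_one_right (by positivity) (hp1 i l)⟩
  have hinj : Function.Injective Φ := by
    intro i j hij
    by_contra hne
    set g : A → ℝ := fun x => ∑ y, P x y * C.accept j y with hg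
    have hg0 : ∀ x, 0 ≤ g x := fun x => Finset.sum_nonneg fun y _ =>
      mul_nonneg (hP x y) (C.accept_mem j y).1
    have hg1 : ∀ x, g x ≤ 1 := fun x => by
      rw [← hP1 x]
      exact Finset.sum_le_sum fun y _ => mul_le_of_le_one_right (hP x y) (C.accept_mem j y).2
    -- Acceptance probability at a representative input; the default 0 for labels outside the image
    -- of `ℓ` is harmless, as these have probability 0.
    let G : Λ → ℝ := fun l => if h : ∃ x, ℓ x = l then g h.choose else 0
    have hG0 : ∀ l, 0 ≤ G l := fun l => by
      simp only [G]; split_ifs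
      · exact hg0 _
      · exact le_rfl
    have hG1 : ∀ l, G l ≤ 1 := fun l => by
      simp only [G]; split_ifs
      · exact hg1 _
      · exact zero_le_one
    have hgG : ∀ x, |g x - G (ℓ x)| ≤ 1 / 16 := fun x => by
      have h : ∃ x', ℓ x' = ℓ x := ⟨x, rfl⟩
      simp only [G, dif_pos h]
      exact hℓ j x _ h.choose_spec.symm
    have havg : ∀ i, |∑ x, C.encode i x * g x - ∑ l, p i l * G l| ≤ 1 / 16 := by
      intro i
      have h1 : ∑ l, p i l * G l = ∑ x, C.encode i x * G (ℓ x) := by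
        simp only [hp, Finset.sum_mul]
        rw [Finset.sum_comm]
        refine Finset.sum_congr rfl fun x _ => ?_
        simp
      rw [h1, ← Finset.sum_sub_distrib]
      refine (Finset.abs_sum_le_sum_abs _ _).trans ?_
      have h2 : ∀ x ∈ Finset.univ, |C.encode i x * g x - C.encode i x * G (ℓ x)| ≤
          C.encode i x * (1 / 16) := fun x _ => by
        rw [← mul_sub, abs_mul, abs_of_nonneg ((C.encode_mem i).1 x)]
        exact mul_le_mul_of_nonneg_left (hgG x) ((C.encode_mem i).1 x)
      refine (Finset.sum_le_sum h2).trans ?_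
      rw [← Finset.sum_mul, (C.encode_mem i).2, one_mul]
    have hclose : ∑ l, p j l * G l - ∑ l, p i l * G l ≤ 1 / 2 := by
      rw [← Finset.sum_sub_distrib]
      have hterm : ∀ l ∈ Finset.univ, p j l * G l - p i l * G l ≤ 1 / (2 * N) := by
        intro l _
        have hNpos : (0 : ℝ) < N := by
          have : 0 < N := Fintype.card_pos_iff.2 ⟨l⟩
          exact_mod_cast this
        have hfl : ⌊2 * N * p i l⌋₊ = ⌊2 * N * p j l⌋₊ :=
          congrArg Fin.val (congrFun hij l)
        have ha := Nat.floor_le (a := 2 * N * p i l) (mul_nonneg (by positivity) (hp0 i l))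
        have hb := Nat.lt_floor_add_one (2 * N * p j l)
        rw [hfl] at ha
        have hc : p j l - p i l ≤ 1 / (2 * N) := by
          rw [le_div_iff₀ (by positivity)]
          linarith
        rw [← sub_mul]
        by_cases hs : 0 ≤ p j l - p i l
        · exact (mul_le_of_le_one_right hs (hG1 l)).trans hc
        · exact (mul_nonpos_of_nonpos_of_nonneg (not_le.1 hs).le (hG0 l)).trans (by positivity)
      refine (Finset.sum_le_sum hterm).trans ?_
      rw [Finset.sum_const, Finset.card_univ, ← hN, nsmul_eq_mul]
      rcases Nat.eq_zero_or_pos N with h0 | h0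
      · simp [h0]
      · have : (0 : ℝ) < N := by exact_mod_cast h0
        apply le_of_eq
        field_simp
    -- Decoder `j` should accept message `j` more often than message `i` by at least `1 - 1/4 =
    -- 3/4`, but the bounds allow only `1/2 + 1/16 + 1/16 = 5/8`.
    have h1 := C.missedDetection_le_typeIError P j
    have h2 := C.falseAcceptance_le_typeIIError P hne
    rw [missedDetection_eq hP1] at h1
    rw [falseAcceptance_eq] at h1 h2
    have h3 := abs_le.1 (havg i)
    have h4 := abs_le.1 (havg j)
    rw [error] at herr
    simp only [hg] at h3 h4
    linarith [h3.1, h3.2, h4.1, h4.2]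
  have := Fintype.card_le_of_injective Φ hinj
  simpa [← hN] using this

end IDCode

/-! ### The converse bound. -/

section Converse

variable {d : ℕ} {U : Matrix (Fin (d + 1)) (Fin (d + 1)) ℝ}

lemma card_le_of_error_le (hU : ∀ a b, 0 < U a b) (hU1 : ∀ a, ∑ b, U a b = 1) {n L s : ℕ}
    (hn : 0 < n) (hs : 0 < s)
    (hsn : 2 * (d * s * √(totalChiSq U * (d + 1) / n)) ≤ 1 / 16)
    (C : IDCode (Fin n → Fin (d + 1)) (Fin n → Fin (d + 1)) L)
    (herr : C.error (noisyPermutationChannel U n) ≤ 1 / 4) :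
    L ≤ (2 * ((d + 1) * (n / s + 1) ^ d) + 1) ^ ((d + 1) * (n / s + 1) ^ d) := by
  have h := C.card_le_of_label
    (fun x y => noisyPermutationChannel_nonneg (fun a b => (hU a b).le) x y)
    (fun x => sum_noisyPermutationChannel hU1 x) (roundedType s)
    (fun j x x' hxx => by
      rw [sum_noisyPermutationChannel_mul, sum_noisyPermutationChannel_mul]
      exact (abs_sub_le_of_roundedType_eq hU hU1 (permAverage_isPermInvariant _)
        (permAverage_mem_Icc (C.accept_mem j)) hn hs hxx).trans hsn) herr
  simpa using h

/-- Codes with small error have at most `2 ^ (K * √n ^ d * log n)` messages. -/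
lemma exists_logb_card_le (hU : ∀ a b, 0 < U a b) (hU1 : ∀ a, ∑ b, U a b = 1) :
    ∃ K : ℝ, 0 < K ∧ ∀ᶠ n : ℕ in atTop, ∀ (L : ℕ)
      (C : IDCode (Fin n → Fin (d + 1)) (Fin n → Fin (d + 1)) L), 2 ≤ L →
      C.error (noisyPermutationChannel U n) ≤ 1 / 4 →
      Real.logb 2 L ≤ K * √(n : ℝ) ^ d * Real.logb 2 n := by
  set v := √(totalChiSq U * (d + 1)) with hv
  have hv0 : 0 ≤ v := Real.sqrt_nonneg _
  -- Chosen so that `2 * d * c * v ≤ 1/16`: rounding at scale `c√n` stays within the tolerance of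
  -- `IDCode.card_le_of_label`.
  set c : ℝ := 1 / (32 * (d + 1) * (v + 1)) with hc
  have hc0 : 0 < c := by positivity
  set K₁ : ℝ := (d + 1) * (2 / c + 1) ^ d with hK₁
  have hK₁0 : 0 < K₁ := by positivity
  set K₂ : ℝ := Real.logb 2 (2 * K₁ + 1) + d with hK₂
  have hK₂0 : 0 < K₂ :=
    add_pos_of_pos_of_nonneg (Real.logb_pos one_lt_two (by linarith)) (by positivity)
  refine ⟨K₁ * K₂, by positivity, ?_⟩
  have hlim : Tendsto (fun n : ℕ => c * √(n : ℝ)) atTop atTop :=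
    (Real.tendsto_sqrt_atTop.comp tendsto_natCast_atTop_atTop).const_mul_atTop hc0
  filter_upwards [hlim.eventually_ge_atTop 2, eventually_ge_atTop 2] with n hn hn2 L C hL herr
  have hn2' : (2 : ℝ) ≤ n := by exact_mod_cast hn2
  set r := √(n : ℝ) with hr
  have hrr : r * r = n := Real.mul_self_sqrt (by positivity)
  have hr1 : 1 ≤ r := by
    rw [hr]; exact Real.one_le_sqrt.2 (by linarith)
  have hr0 : 0 < r := by linarith
  set s := ⌊c * r⌋₊ with hs
  have hs_le : (s : ℝ) ≤ c * r := Nat.floor_le (by positivity)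
  have hs_ge : c * r / 2 ≤ s := by
    have := Nat.lt_floor_add_one (c * r)
    rw [← hs] at this
    linarith
  have hs0 : 0 < s := by
    have : (0 : ℝ) < s := by linarith
    exact_mod_cast this
  have hsn : 2 * (d * s * √(totalChiSq U * (d + 1) / n)) ≤ 1 / 16 := by
    rw [Real.sqrt_div' _ (by positivity), ← hv, ← hr]
    have h1 : s * (v / r) ≤ c * v := by
      rw [← mul_div_assoc, div_le_iff₀ hr0]
      nlinarith
    have h2 : (d : ℝ) * (c * v) ≤ 1 / 32 := by
      have : (d : ℝ) * (c * v) = (d * v) / (32 * (d + 1) * (v + 1)) := by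
        rw [hc]; ring
      rw [this, div_le_iff₀ (by positivity)]
      have hd : (0 : ℝ) ≤ d := by positivity
      nlinarith
    have h3 : (d : ℝ) * (s * (v / r)) ≤ d * (c * v) := mul_le_mul_of_nonneg_left h1 (by positivity)
    nlinarith
  have hcard := card_le_of_error_le hU hU1 (by omega) hs0 hsn C herr
  set N := (d + 1) * (n / s + 1) ^ d with hN
  have hNpos : (1 : ℝ) ≤ N := by
    have : 1 ≤ N := Nat.mul_pos d.succ_pos (pow_pos (Nat.succ_pos _) d)
    exact_mod_cast this
  have hNle : (N : ℝ) ≤ K₁ * r ^ d := by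
    have h1 : ((n / s : ℕ) : ℝ) ≤ 2 / c * r := by
      refine Nat.cast_div_le.trans ?_
      rw [div_le_iff₀ (by exact_mod_cast hs0)]
      have : 2 / c * r * (c * r / 2) = n := by
        rw [← hrr]; field_simp
      rw [← this]
      exact mul_le_mul_of_nonneg_left hs_ge (by positivity)
    have h2 : ((n / s : ℕ) : ℝ) + 1 ≤ (2 / c + 1) * r := by linarith
    rw [hN]
    push_cast
    rw [hK₁, mul_assoc, ← mul_pow]
    refine mul_le_mul_of_nonneg_left ?_ (by positivity)
    exact pow_le_pow_left₀ (by positivity) (by exact_mod_cast h2) d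
  have hlogn : 1 ≤ Real.logb 2 n := by
    rw [Real.le_logb_iff_rpow_le one_lt_two (by linarith)]
    simpa using hn2'
  have hrd : 1 ≤ r ^ d := one_le_pow₀ hr1
  have hlogN : Real.logb 2 (2 * N + 1) ≤ K₂ * Real.logb 2 n := by
    have h1 : 2 * (N : ℝ) + 1 ≤ (2 * K₁ + 1) * (n : ℝ) ^ d := by
      -- A crude bound suffices here, since this quantity enters only through its logarithm.
      have h2 : r ^ d ≤ (n : ℝ) ^ d := pow_le_pow_left₀ hr0.le (by nlinarith) d
      nlinarith
    calc Real.logb 2 (2 * N + 1) ≤ Real.logb 2 ((2 * K₁ + 1) * (n : ℝ) ^ d) :=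
          Real.logb_le_logb_of_le one_lt_two (by positivity) h1
      _ = Real.logb 2 (2 * K₁ + 1) + d * Real.logb 2 n := by
          rw [Real.logb_mul (by positivity) (by positivity), Real.logb_pow]
      _ ≤ K₂ * Real.logb 2 n := by
          have := Real.logb_pos one_lt_two (show 1 < 2 * K₁ + 1 by linarith)
          rw [hK₂]
          nlinarith
  calc Real.logb 2 L ≤ Real.logb 2 ((2 * N + 1) ^ N) :=
        Real.logb_le_logb_of_le one_lt_two (by positivity) (by exact_mod_cast hcard)
    _ = N * Real.logb 2 (2 * N + 1) := Real.logb_pow _ _ _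
    _ ≤ (K₁ * r ^ d) * (K₂ * Real.logb 2 n) :=
        mul_le_mul hNle hlogN (Real.logb_nonneg one_lt_two (by linarith)) (by positivity)
    _ = K₁ * K₂ * r ^ d * Real.logb 2 n := by ring

lemma tendsto_logb_two_natCast : Tendsto (fun n : ℕ => Real.logb 2 (n : ℝ)) atTop atTop :=
  (Real.tendsto_logb_atTop one_lt_two).comp tendsto_natCast_atTop_atTop

lemma tendsto_logb_div_self : Tendsto (fun t : ℝ => Real.logb 2 t / t) atTop (𝓝 0) := by
  have h := (Real.isLittleO_log_id_atTop.tendsto_div_nhds_zero).div_const (Real.log 2)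
  rw [zero_div] at h
  refine h.congr fun t => ?_
  simp only [id, Real.logb]
  ring

theorem IsAchievableIDRate.le (hU : ∀ a b, 0 < U a b) (hU1 : ∀ a, ∑ b, U a b = 1) {R : ℝ}
    (hR : IsAchievableIDRate U R) : R ≤ d / 2 := by
  obtain ⟨n, L, C, hL, hn, hrate, herr⟩ := hR
  obtain ⟨K, hK, hbound⟩ := exists_logb_card_le hU hU1
  have hlim : Tendsto (fun m : ℕ => Real.logb 2 K / Real.logb 2 m + d / 2 +
      Real.logb 2 (Real.logb 2 m) / Real.logb 2 m) atTop (𝓝 (0 + d / 2 + 0)) :=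
    ((tendsto_logb_two_natCast.const_div_atTop _).add_const _).add
      (tendsto_logb_div_self.comp tendsto_logb_two_natCast)
  rw [zero_add, add_zero] at hlim
  refine le_of_tendsto_of_tendsto hrate (hlim.comp hn) ?_
  filter_upwards [hn.eventually hbound, hn.eventually (eventually_ge_atTop 2),
    herr.eventually (ge_mem_nhds (show (0 : ℝ) < 1 / 4 by norm_num))] with k hk hnk hek
  have hk := hk (L k) (C k) (hL k) hek
  have hn2 : (2 : ℝ) ≤ n k := by exact_mod_cast hnk
  have hL2 : (2 : ℝ) ≤ L k := by exact_mod_cast hL k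
  have hlogn : 1 ≤ Real.logb 2 (n k) := by
    rw [Real.le_logb_iff_rpow_le one_lt_two (by linarith)]
    simpa using hn2
  have hlogL : 1 ≤ Real.logb 2 (L k) := by
    rw [Real.le_logb_iff_rpow_le one_lt_two (by linarith)]
    simpa using hL2
  have hsq : Real.logb 2 √(n k : ℝ) = Real.logb 2 (n k) / 2 := by
    rw [Real.logb, Real.log_sqrt (by positivity), Real.logb]; ring
  have hsq0 : √(n k : ℝ) ^ d ≠ 0 := by positivity
  have h1 : Real.logb 2 (Real.logb 2 (L k)) ≤
      Real.logb 2 K + d * (Real.logb 2 (n k) / 2) + Real.logb 2 (Real.logb 2 (n k)) := by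
    rw [← hsq, ← Real.logb_pow, ← Real.logb_mul hK.ne' hsq0,
      ← Real.logb_mul (mul_ne_zero hK.ne' hsq0) (by linarith)]
    exact Real.logb_le_logb_of_le one_lt_two (by linarith) hk
  simp only [idRate, Function.comp]
  rw [div_le_iff₀ (by linarith)]
  refine h1.trans (le_of_eq ?_)
  have : Real.logb 2 (n k) ≠ 0 := by linarith
  field_simp

end Converse

/-! ### Words with few agreements. -/

section GilbertVarshamov

/-- Number of positions in which two words agree. -/
def agreement {m : ℕ} {α : Type*} [DecidableEq α] (f g : Fin m → α) : ℕ :=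
  (Finset.univ.filter fun k => f k = g k).card

lemma agreement_comm {m : ℕ} {α : Type*} [DecidableEq α] (f g : Fin m → α) :
    agreement f g = agreement g f := by
  simp only [agreement, eq_comm]

/-- Union bound over agreement sets: there are at most `2 ^ m` sets `S` with `t * |S| ≥ 2m`, and
each leaves at most `2 ^ (tm - 2m)` words agreeing with `f` on `S`. -/
lemma card_agreement_ge_mul_le (m t : ℕ) (f : Fin m → Fin (2 ^ t)) :
    (Finset.univ.filter fun g : Fin m → Fin (2 ^ t) => 2 * m ≤ t * agreement f g).card * 2 ^ m ≤
      2 ^ (t * m) := by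
  classical
  set 𝒮 := (Finset.univ : Finset (Finset (Fin m))).filter fun S => 2 * m ≤ t * S.card with h𝒮
  have hsub : (Finset.univ.filter fun g : Fin m → Fin (2 ^ t) => 2 * m ≤ t * agreement f g) ⊆
      𝒮.biUnion fun S => Fintype.piFinset fun k => if k ∈ S then {f k} else Finset.univ := by
    intro g hg
    rw [Finset.mem_filter] at hg
    refine Finset.mem_biUnion.2 ⟨Finset.univ.filter fun k => f k = g k,
      Finset.mem_filter.2 ⟨Finset.mem_univ _, hg.2⟩, Fintype.mem_piFinset.2 fun k => ?_⟩
    split_ifs with h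
    · simpa [eq_comm] using h
    · exact Finset.mem_univ _
  have hcard : ∀ S ∈ 𝒮, (Fintype.piFinset fun k => if k ∈ S then {f k} else
      (Finset.univ : Finset (Fin (2 ^ t)))).card * 2 ^ (2 * m) ≤ 2 ^ (t * m) := by
    intro S hS
    have h1 : (Fintype.piFinset fun k => if k ∈ S then {f k} else
        (Finset.univ : Finset (Fin (2 ^ t)))).card = (2 ^ t) ^ (m - S.card) := by
      rw [Fintype.card_piFinset]
      have : ∀ k, (if k ∈ S then {f k} else (Finset.univ : Finset (Fin (2 ^ t)))).card =
          if k ∈ S then 1 else 2 ^ t := fun k => by split_ifs <;> simp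
      simp only [this]
      rw [Finset.prod_ite]
      simp only [Finset.prod_const_one, one_mul, Finset.prod_const]
      congr 1
      have : (Finset.univ.filter fun k => k ∉ S) = Sᶜ := by ext; simp
      rw [this, Finset.card_compl, Fintype.card_fin]
    rw [h1, ← pow_mul, ← pow_add]
    refine Nat.pow_le_pow_right two_pos ?_
    have hS2 := (Finset.mem_filter.1 hS).2
    have hle : S.card ≤ m := (Finset.card_le_univ S).trans (by simp)
    calc t * (m - S.card) + 2 * m ≤ t * (m - S.card) + t * S.card := by omega
      _ = t * m := by rw [← mul_add, Nat.sub_add_cancel hle]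
  have hB : (Finset.univ.filter fun g : Fin m → Fin (2 ^ t) =>
      2 * m ≤ t * agreement f g).card * 2 ^ (2 * m) ≤ 2 ^ m * 2 ^ (t * m) := by
    calc _ ≤ (∑ S ∈ 𝒮, (Fintype.piFinset fun k => if k ∈ S then {f k} else
          (Finset.univ : Finset (Fin (2 ^ t)))).card) * 2 ^ (2 * m) :=
          Nat.mul_le_mul_right _ ((Finset.card_le_card hsub).trans Finset.card_biUnion_le)
      _ ≤ ∑ _S ∈ 𝒮, 2 ^ (t * m) := by
          rw [Finset.sum_mul]; exact Finset.sum_le_sum hcard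
      _ ≤ 2 ^ m * 2 ^ (t * m) := by
          rw [Finset.sum_const, smul_eq_mul]
          refine Nat.mul_le_mul_right _ ((Finset.card_le_univ 𝒮).trans ?_)
          simp
  refine Nat.le_of_mul_le_mul_right (c := 2 ^ m) ?_ (by positivity)
  calc _ = _ * 2 ^ (2 * m) := by rw [two_mul m, pow_add, ← mul_assoc]
    _ ≤ 2 ^ m * 2 ^ (t * m) := hB
    _ = 2 ^ (t * m) * 2 ^ m := mul_comm _ _

/-- A Gilbert-Varshamov type bound: there are `2 ^ m` words of length `m` over an alphabet of size
`2 ^ t`, any two of which agree in a fraction of less than `2 / t` of the positions. -/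
lemma exists_family_agreement_lt (m t : ℕ) (ht : 2 ≤ t) :
    ∃ F : Fin (2 ^ m) → Fin m → Fin (2 ^ t),
      ∀ i j, i ≠ j → t * agreement (F i) (F j) < 2 * m := by
  classical
  rcases Nat.eq_zero_or_pos m with rfl | hm
  · refine ⟨fun _ => Fin.elim0, fun i j hij => absurd ?_ hij⟩
    exact Fin.ext (by have := i.2; have := j.2; simp at *)
  let good : Finset (Finset (Fin m → Fin (2 ^ t))) := Finset.univ.filter fun S =>
    ∀ f ∈ S, ∀ g ∈ S, f ≠ g → t * agreement f g < 2 * m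
  obtain ⟨S, hS, hmax⟩ := Finset.exists_max_image good Finset.card
    ⟨∅, Finset.mem_filter.2 ⟨Finset.mem_univ _, by simp⟩⟩
  have hSg := (Finset.mem_filter.1 hS).2
  have hcover : (Finset.univ : Finset (Fin m → Fin (2 ^ t))) ⊆ S.biUnion fun f =>
      Finset.univ.filter fun g => 2 * m ≤ t * agreement f g := by
    intro g _
    rw [Finset.mem_biUnion]
    by_contra! hcon
    have hfar : ∀ f ∈ S, t * agreement f g < 2 * m := fun f hf => by
      have := hcon f hf
      simpa using this
    -- A word agrees with itself everywhere, so `t ≥ 2` excludes `g` from `S` and inserting it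
    -- contradicts maximality.
    have hgS : g ∉ S := fun hg => by
      have h1 := hfar g hg
      have h2 : agreement g g = m := by simp [agreement]
      rw [h2] at h1
      exact absurd (Nat.mul_le_mul_right m ht) (not_le.2 h1)
    have hins : insert g S ∈ good := by
      refine Finset.mem_filter.2 ⟨Finset.mem_univ _, fun f hf f' hf' hne => ?_⟩
      rcases Finset.mem_insert.1 hf with rfl | hfS
      · rcases Finset.mem_insert.1 hf' with rfl | hfS'
        · exact absurd rfl hne
        · rw [agreement_comm]; exact hfar f' hfS'
      · rcases Finset.mem_insert.1 hf' with rfl | hfS'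
        · exact hfar f hfS
        · exact hSg f hfS f' hfS' hne
    have := hmax _ hins
    rw [Finset.card_insert_of_notMem hgS] at this
    omega
  have hcard : 2 ^ m ≤ S.card := by
    have h1 := (Finset.card_le_card hcover).trans Finset.card_biUnion_le
    rw [Finset.card_univ, Fintype.card_fun, Fintype.card_fin, Fintype.card_fin, ← pow_mul] at h1
    have h2 := Nat.mul_le_mul_right (2 ^ m) h1
    rw [Finset.sum_mul] at h2
    have h3 := h2.trans (Finset.sum_le_sum fun f _ => card_agreement_ge_mul_le m t f)
    rw [Finset.sum_const, smul_eq_mul, mul_comm] at h3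
    exact Nat.le_of_mul_le_mul_right h3 (by positivity)
  obtain ⟨T, hTS, hT⟩ := Finset.exists_subset_card_eq hcard
  let e := (Finset.equivFinOfCardEq hT).symm
  refine ⟨fun i => (e i).1, fun i j hij => ?_⟩
  exact hSg _ (hTS (e i).2) _ (hTS (e j).2) fun h => hij (e.injective (Subtype.ext h))

end GilbertVarshamov

/-! ### Identification codes from transmission codes. -/

section FromTransmission

variable {A B : Type*} [Fintype A] [Fintype B]

lemma IDCode.error_nonneg {L : ℕ} {P : A → B → ℝ} (hP : ∀ x y, 0 ≤ P x y) (C : IDCode A B L) :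
    0 ≤ C.error P := by
  refine add_nonneg (Real.iSup_nonneg fun i => ?_) (Real.iSup_nonneg fun p => ?_)
  · exact Finset.sum_nonneg fun x _ => Finset.sum_nonneg fun y _ =>
      mul_nonneg (mul_nonneg ((C.encode_mem i).1 x) (hP x y)) (sub_nonneg.2 (C.accept_mem i y).2)
  · exact Finset.sum_nonneg fun x _ => Finset.sum_nonneg fun y _ =>
      mul_nonneg (mul_nonneg ((C.encode_mem _).1 x) (hP x y)) (C.accept_mem _ y).1

/-- A transmission code for `m * 2 ^ t` messages with disjoint decoding regions yields an
identification code for `2 ^ m` messages with deterministic decoders. -/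
lemma exists_idCode_of_transmissionCode {P : A → B → ℝ} (hP : ∀ x y, 0 ≤ P x y)
    (hP1 : ∀ x, ∑ y, P x y = 1) {m t : ℕ} (hm : 0 < m) (ht : 2 ≤ t)
    (c : Fin m × Fin (2 ^ t) → A) (E : Fin m × Fin (2 ^ t) → Set B)
    (hE : ∀ w w', w ≠ w' → ∀ y, y ∈ E w → y ∉ E w') {η : ℝ} (hη : 0 ≤ η)
    (hc : ∀ w, ∑ y, P (c w) y * (1 - (E w).indicator (fun _ => (1 : ℝ)) y) ≤ η) :
    ∃ C : IDCode A B (2 ^ m), C.HasDeterministicDecoders ∧ C.error P ≤ 2 * η + 2 / t := by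
  classical
  obtain ⟨F, hF⟩ := exists_family_agreement_lt m t ht
  have hm0 : (0 : ℝ) < m := by exact_mod_cast hm
  have ht0 : (0 : ℝ) < t := by exact_mod_cast (by omega : 0 < t)
  -- Message `i` is sent as a uniformly random point of the graph of `F i`; decoder `j` accepts on
  -- the union of the regions along the graph of `F j`.
  let enc : Fin (2 ^ m) → A → ℝ := fun i x => ∑ k, if c (k, F i k) = x then 1 / (m : ℝ) else 0
  have hsum : ∀ i (h : A → ℝ), ∑ x, enc i x * h x = ∑ k, 1 / (m : ℝ) * h (c (k, F i k)) := by
    intro i h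
    simp only [enc, Finset.sum_mul]
    rw [Finset.sum_comm]
    refine Finset.sum_congr rfl fun k _ => ?_
    simp
  let C : IDCode A B (2 ^ m) :=
    { encode := enc
      encode_mem := fun i => ⟨fun x => Finset.sum_nonneg fun k _ => by
          split_ifs
          · positivity
          · exact le_rfl, by
          have := hsum i (fun _ => 1)
          simp only [mul_one] at this
          rw [this, Finset.sum_const, Finset.card_univ, Fintype.card_fin, nsmul_eq_mul]
          field_simp⟩
      accept := fun j y => if ∃ k, y ∈ E (k, F j k) then 1 else 0
      accept_mem := fun j y => by
        split_ifs <;> simp }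
  have hdet : C.HasDeterministicDecoders := fun i y => by
    change (if ∃ k, y ∈ E (k, F i k) then (1 : ℝ) else 0) = 0 ∨
      (if ∃ k, y ∈ E (k, F i k) then (1 : ℝ) else 0) = 1
    split_ifs <;> simp
  have hacc : ∀ j y, C.accept j y = if ∃ k, y ∈ E (k, F j k) then (1 : ℝ) else 0 :=
    fun j y => rfl
  have hmiss : ∀ i, C.missedDetection P i ≤ η := by
    intro i
    have h1 : C.missedDetection P i =
        ∑ x, enc i x * ∑ y, P x y * (1 - C.accept i y) := by
      simp only [IDCode.missedDetection, Finset.mul_sum, mul_assoc]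
      rfl
    rw [h1, hsum]
    have h2 : ∀ k ∈ Finset.univ, 1 / (m : ℝ) *
        ∑ y, P (c (k, F i k)) y * (1 - C.accept i y) ≤ 1 / (m : ℝ) * η := by
      intro k _
      refine mul_le_mul_of_nonneg_left (le_trans (Finset.sum_le_sum fun y _ => ?_)
        (hc (k, F i k))) (by positivity)
      refine mul_le_mul_of_nonneg_left (sub_le_sub_left ?_ 1) (hP _ _)
      by_cases hy : y ∈ E (k, F i k)
      · rw [hacc, if_pos ⟨k, hy⟩, Set.indicator_of_mem hy]
      · rw [Set.indicator_of_notMem hy]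
        exact (C.accept_mem i y).1
    refine (Finset.sum_le_sum h2).trans (le_of_eq ?_)
    rw [Finset.sum_const, Finset.card_univ, Fintype.card_fin, nsmul_eq_mul]
    field_simp
  have hfalse : ∀ i j, i ≠ j → C.falseAcceptance P i j ≤ η + 2 / t := by
    intro i j hij
    rw [IDCode.falseAcceptance_eq]
    change ∑ x, enc i x * ∑ y, P x y * C.accept j y ≤ _
    rw [hsum]
    -- Where `F i k = F j k` the trivial bound 1 is used, at a fraction below `2 / t` of the `k`.
    -- Elsewhere `(k, F i k)` is off the graph of `F j`, so acceptance requires a transmission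
    -- error.
    have h2 : ∀ k ∈ Finset.univ, 1 / (m : ℝ) * ∑ y, P (c (k, F i k)) y * C.accept j y ≤
        1 / (m : ℝ) * (η + if F i k = F j k then 1 else 0) := by
      intro k _
      refine mul_le_mul_of_nonneg_left ?_ (by positivity)
      split_ifs with hk
      · have : ∑ y, P (c (k, F i k)) y * C.accept j y ≤ 1 := by
          rw [← hP1 (c (k, F i k))]
          exact Finset.sum_le_sum fun y _ => mul_le_of_le_one_right (hP _ _) (C.accept_mem j y).2
        linarith
      · rw [add_zero]
        refine le_trans (Finset.sum_le_sum fun y _ => ?_) (hc (k, F i k))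
        refine mul_le_mul_of_nonneg_left ?_ (hP _ _)
        by_cases hy : ∃ k', y ∈ E (k', F j k')
        · obtain ⟨k', hk'⟩ := hy
          have hne : (k', F j k') ≠ (k, F i k) := by
            rintro h
            obtain ⟨h1, h2⟩ := Prod.mk.inj h
            subst h1
            exact hk h2.symm
          rw [Set.indicator_of_notMem (hE _ _ hne y hk'), sub_zero]
          exact (C.accept_mem j y).2
        · rw [hacc, if_neg hy, sub_nonneg]
          exact Set.indicator_le_self' (f := fun _ => (1 : ℝ)) (fun _ _ => zero_le_one) y
    refine (Finset.sum_le_sum h2).trans ?_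
    rw [← Finset.mul_sum, Finset.sum_add_distrib, Finset.sum_const, Finset.card_univ,
      Fintype.card_fin, nsmul_eq_mul]
    have h3 : ∑ k, (if F i k = F j k then (1 : ℝ) else 0) = agreement (F i) (F j) := by
      simp [agreement]
    rw [h3, mul_add]
    have h4 : (t : ℝ) * agreement (F i) (F j) < 2 * m := by exact_mod_cast hF i j hij
    have h5 : 1 / (m : ℝ) * (m * η) = η := by field_simp
    have h6 : 1 / (m : ℝ) * agreement (F i) (F j) ≤ 2 / t := by
      rw [le_div_iff₀ ht0, one_div, inv_mul_eq_div, div_mul_eq_mul_div, div_le_iff₀ hm0]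
      linarith
    rw [h5]
    linarith
  refine ⟨C, hdet, ?_⟩
  have h1 : C.typeIError P ≤ η := Real.iSup_le hmiss hη
  have h2 : C.typeIIError P ≤ η + 2 / t :=
    Real.iSup_le (fun p => hfalse _ _ p.2) (by positivity)
  rw [IDCode.error]
  linarith

end FromTransmission

/-! ### Reliable transmission by grids of letter counts. -/

section Transmission

variable {d : ℕ} {U : Matrix (Fin (d + 1)) (Fin (d + 1)) ℝ}

/-- Unbiased estimate, from a channel output, of the number of letters `a` in the input, where `V`
is the inverse of the channel matrix. -/
def countEstimate {q n : ℕ} (V : Matrix (Fin q) (Fin q) ℝ) (a : Fin q) (y : Fin n → Fin q) : ℝ :=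
  ∑ i, V (y i) a

lemma countEstimate_isPermInvariant {q n : ℕ} (V : Matrix (Fin q) (Fin q) ℝ) (a : Fin q)
    (σ : Equiv.Perm (Fin n)) (y : Fin n → Fin q) :
    countEstimate V a (y ∘ σ) = countEstimate V a y :=
  Equiv.sum_comp σ fun i => V (y i) a

/-- `U * V = 1` makes each `V (y i) a` an unbiased estimate of the indicator of `x i = a`;
independence makes the variances add up to `O(n)`, uniformly in `x`. -/
lemma exists_memorylessExpectation_countEstimate_le {q : ℕ} {U V : Matrix (Fin q) (Fin q) ℝ}
    (hU : ∀ a b, 0 ≤ U a b) (hU1 : ∀ a, ∑ b, U a b = 1) (hUV : U * V = 1) :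
    ∃ K : ℝ, 0 ≤ K ∧ ∀ (n : ℕ) (x : Fin n → Fin q) (a : Fin q),
      memorylessExpectation U x (fun y => (countEstimate V a y - letterCount x a) ^ 2) ≤
        n * K := by
  have hterm : ∀ a b, 0 ≤ ∑ c, U b c * (V c a - if b = a then 1 else 0) ^ 2 := fun a b =>
    Finset.sum_nonneg fun c _ => mul_nonneg (hU b c) (sq_nonneg _)
  refine ⟨∑ a, ∑ b, ∑ c, U b c * (V c a - if b = a then 1 else 0) ^ 2,
    Finset.sum_nonneg fun a _ => Finset.sum_nonneg fun b _ => hterm a b, fun n x a => ?_⟩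
  set φ : Fin n → Fin q → ℝ := fun i c => V c a - if x i = a then 1 else 0 with hφ
  have h1 : ∀ y : Fin n → Fin q, countEstimate V a y - letterCount x a = ∑ i, φ i (y i) := by
    intro y
    simp [hφ, countEstimate, letterCount, Finset.sum_sub_distrib]
  have h0 : ∀ i, ∑ c, U (x i) c * φ i c = 0 := by
    intro i
    have := congrFun (congrFun hUV (x i)) a
    rw [Matrix.mul_apply, Matrix.one_apply] at this
    simp only [hφ, mul_sub, Finset.sum_sub_distrib, this, ← Finset.sum_mul, hU1, one_mul, sub_self]
  simp only [h1]
  rw [memorylessExpectation_sum_sq hU1 x φ h0]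
  have h2 : ∀ i ∈ Finset.univ, ∑ c, U (x i) c * φ i c ^ 2 ≤
      ∑ a, ∑ b, ∑ c, U b c * (V c a - if b = a then 1 else 0) ^ 2 := by
    intro i _
    refine le_trans (Finset.single_le_sum
      (f := fun b => ∑ c, U b c * (V c a - if b = a then 1 else 0) ^ 2)
      (fun b _ => hterm a b) (Finset.mem_univ (x i))) ?_
    exact Finset.single_le_sum
      (f := fun a => ∑ b, ∑ c, U b c * (V c a - if b = a then 1 else 0) ^ 2)
      (fun a _ => Finset.sum_nonneg fun b _ => hterm a b) (Finset.mem_univ a)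
  refine (Finset.sum_le_sum h2).trans (le_of_eq ?_)
  simp

/-- Transmission over the noisy permutation channel: inputs whose letter counts form a grid of
spacing `Δ`, decoded by estimating the counts. -/
lemma exists_transmissionCode (hU : ∀ a b, 0 ≤ U a b) (hU1 : ∀ a, ∑ b, U a b = 1)
    (hUdet : IsUnit U.det) :
    ∃ K : ℝ, 0 ≤ K ∧ ∀ n G Δ : ℕ, 0 < Δ → d * (G * Δ) ≤ n →
      ∃ (c : (Fin d → Fin G) → Fin n → Fin (d + 1))
        (E : (Fin d → Fin G) → Set (Fin n → Fin (d + 1))),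
        (∀ w w', w ≠ w' → ∀ y, y ∈ E w → y ∉ E w') ∧
        ∀ w, ∑ y, noisyPermutationChannel U n (c w) y *
          (1 - (E w).indicator (fun _ => (1 : ℝ)) y) ≤ K * n / Δ ^ 2 := by
  classical
  obtain ⟨K, hK0, hK⟩ := exists_memorylessExpectation_countEstimate_le (V := U⁻¹) hU hU1
    (Matrix.mul_nonsing_inv U hUdet)
  refine ⟨4 * d * K, by positivity, fun n G Δ hΔ hG => ?_⟩
  have hΔ0 : (0 : ℝ) < Δ := by exact_mod_cast hΔ
  have hx : ∀ w : Fin d → Fin G, ∃ x : Fin n → Fin (d + 1),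
      ∀ i : Fin d, letterCount x i.succ = Δ * w i := by
    intro w
    have hle : ∑ i, Δ * (w i : ℕ) ≤ n := by
      refine le_trans (Finset.sum_le_card_nsmul _ _ (G * Δ) fun i _ => ?_) (by simpa using hG)
      rw [mul_comm G]
      exact Nat.mul_le_mul_left _ (w i).2.le
    -- Letter 0 is a filler that absorbs the remaining positions; the data sit in the other `d`
    -- counts.
    obtain ⟨x, hx⟩ := exists_letterCount_eq (n := n)
      (Fin.cons (n - ∑ i, Δ * (w i : ℕ)) fun i => Δ * (w i : ℕ)) (by
        rw [Fin.sum_univ_succ]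
        simp only [Fin.cons_zero, Fin.cons_succ]
        omega)
    exact ⟨x, fun i => by rw [hx]; simp⟩
  choose c hc using hx
  let E : (Fin d → Fin G) → Set (Fin n → Fin (d + 1)) := fun w =>
    {y | ∀ i : Fin d, |countEstimate U⁻¹ i.succ y - Δ * (w i : ℕ)| < Δ / 2}
  refine ⟨c, E, ?_, fun w => ?_⟩
  · intro w w' hne y hy hy'
    apply hne
    funext i
    have h1 := abs_lt.1 (hy i)
    have h2 := abs_lt.1 (hy' i)
    have h3 : (Δ : ℝ) * (w i : ℕ) < Δ * ((w' i : ℕ) + 1) := by linarith [h1.1, h2.2]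
    have h4 : (Δ : ℝ) * (w' i : ℕ) < Δ * ((w i : ℕ) + 1) := by linarith [h1.2, h2.1]
    have h5 := lt_of_mul_lt_mul_left h3 hΔ0.le
    have h6 := lt_of_mul_lt_mul_left h4 hΔ0.le
    norm_cast at h5 h6
    apply Fin.ext
    omega
  · have hinv : IsPermInvariant (fun y => 1 - (E w).indicator (fun _ => (1 : ℝ)) y) := by
      intro σ y
      have : y ∘ σ ∈ E w ↔ y ∈ E w := by
        simp only [E, Set.mem_ofPred_eq, countEstimate_isPermInvariant]
      by_cases hy : y ∈ E w
      · simp [this.2 hy, hy]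
      · simp [mt this.1 hy, hy]
    rw [sum_noisyPermutationChannel_mul, hinv.permAverage_eq]
    -- Chebyshev with a union bound: outside `E w` some estimate is off by at least `Δ / 2`.
    have hbound : ∀ y, 1 - (E w).indicator (fun _ => (1 : ℝ)) y ≤
        ∑ i : Fin d, 4 / (Δ : ℝ) ^ 2 *
          (countEstimate U⁻¹ i.succ y - letterCount (c w) i.succ) ^ 2 := by
      intro y
      have hnn : ∀ i ∈ Finset.univ, 0 ≤ 4 / (Δ : ℝ) ^ 2 *
          (countEstimate U⁻¹ (Fin.succ i) y - letterCount (c w) (Fin.succ i)) ^ 2 :=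
        fun i _ => by positivity
      by_cases hy : y ∈ E w
      · rw [Set.indicator_of_mem hy, sub_self]
        exact Finset.sum_nonneg hnn
      · rw [Set.indicator_of_notMem hy, sub_zero]
        simp only [E, Set.mem_ofPred_eq, not_forall, not_lt] at hy
        obtain ⟨i, hi⟩ := hy
        refine le_trans ?_ (Finset.single_le_sum hnn (Finset.mem_univ i))
        rw [hc, div_mul_eq_mul_div, le_div_iff₀ (by positivity), ← sq_abs (_ - _)]
        push_cast
        nlinarith
    refine (memorylessExpectation_mono hU _ hbound).trans ?_
    rw [memorylessExpectation_sum]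
    simp only [memorylessExpectation_const_mul]
    refine (Finset.sum_le_sum fun i _ =>
      mul_le_mul_of_nonneg_left (hK n (c w) (Fin.succ i)) (by positivity)).trans (le_of_eq ?_)
    rw [Finset.sum_const, Finset.card_univ, Fintype.card_fin, nsmul_eq_mul]
    ring

end Transmission

lemma IsAchievableIDRateDetDecoders.isAchievableIDRate {q : ℕ} {U : Matrix (Fin q) (Fin q) ℝ}
    {R : ℝ} (h : IsAchievableIDRateDetDecoders U R) : IsAchievableIDRate U R := by
  obtain ⟨n, L, C, -, h⟩ := h
  exact ⟨n, L, C, h⟩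

/-! ### Choice of parameters and the limit of the rates. -/

section Achievability

variable {d : ℕ} {U : Matrix (Fin (d + 1)) (Fin (d + 1)) ℝ}

/-- All parameters are powers of 2. Up to constants, `√n = 2 ^ ((r+2)(k+2))`, the spacing exceeds it
by `2 ^ (k+2)`, and the grid has side `2 ^ ((r+1)(k+2))`. With `e = d(r+1) - 1`, its `2 ^
((e+1)(k+2))` points split as `m * 2 ^ t` with `t = k + 2` and `m = 2 ^ (e(k+2))`, giving rate `e /
(2(r+2))` in the limit. -/
lemma isAchievableIDRateDetDecoders_of_grid (hd : 0 < d) (hU : ∀ a b, 0 ≤ U a b)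
    (hU1 : ∀ a, ∑ b, U a b = 1) (hUdet : IsUnit U.det) (r : ℕ) :
    IsAchievableIDRateDetDecoders U (((d : ℝ) * (r + 1) - 1) / (2 * (r + 2))) := by
  obtain ⟨K, hK0, hK⟩ := exists_transmissionCode hU hU1 hUdet
  obtain ⟨e, he⟩ : ∃ e, d * (r + 1) = e + 1 :=
    Nat.exists_eq_succ_of_ne_zero (Nat.mul_pos hd r.succ_pos).ne'
  -- The extra `d + 1` in the exponent makes room for the factor `d ≤ 2 ^ d` and for the `+ 1` in
  -- the exponent of the spacing; `k + 2` ensures `t ≥ 2`.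
  let n : ℕ → ℕ := fun k => 2 ^ (2 * (r + 2) * (k + 2) + (d + 1))
  have hcode : ∀ k, ∃ C : IDCode (Fin (n k) → Fin (d + 1)) (Fin (n k) → Fin (d + 1))
      (2 ^ 2 ^ (e * (k + 2))), C.HasDeterministicDecoders ∧
      C.error (noisyPermutationChannel U (n k)) ≤
        2 * (K * n k / ((2 ^ ((r + 3) * (k + 2) + 1) : ℕ) : ℝ) ^ 2) + 2 / (k + 2 : ℕ) := by
    intro k
    obtain ⟨c, E, hE, hc⟩ := hK (n k) (2 ^ ((r + 1) * (k + 2))) (2 ^ ((r + 3) * (k + 2) + 1))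
      (by positivity) (by
        calc d * (2 ^ ((r + 1) * (k + 2)) * 2 ^ ((r + 3) * (k + 2) + 1))
            ≤ 2 ^ d * (2 ^ ((r + 1) * (k + 2)) * 2 ^ ((r + 3) * (k + 2) + 1)) :=
              Nat.mul_le_mul_right _ Nat.lt_two_pow_self.le
          _ = n k := by
              simp only [n, ← pow_add]
              congr 1
              ring)
    have hcard : Fintype.card (Fin (2 ^ (e * (k + 2))) × Fin (2 ^ (k + 2))) =
        Fintype.card (Fin d → Fin (2 ^ ((r + 1) * (k + 2)))) := by
      simp only [Fintype.card_prod, Fintype.card_fin, Fintype.card_fun, ← pow_mul, ← pow_add]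
      congr 1
      calc e * (k + 2) + (k + 2) = (e + 1) * (k + 2) := by ring
        _ = (r + 1) * (k + 2) * d := by rw [← he]; ring
    let ι := Fintype.equivOfCardEq hcard
    exact exists_idCode_of_transmissionCode (noisyPermutationChannel_nonneg hU)
      (sum_noisyPermutationChannel hU1) (by positivity) (by omega) (c ∘ ι) (E ∘ ι)
      (fun w w' hne => hE _ _ (ι.injective.ne hne)) (by positivity) (fun w => hc (ι w))
  choose C hdet herr using hcode
  have hshift : Tendsto (fun k : ℕ => k + 2) atTop atTop := tendsto_add_atTop_nat 2
  refine ⟨n, fun k => 2 ^ 2 ^ (e * (k + 2)), C, hdet, fun k => ?_, ?_, ?_, ?_⟩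
  · exact Nat.le_self_pow (by positivity) 2
  · refine tendsto_atTop_mono (fun k => ?_) tendsto_id
    calc k ≤ 2 * (r + 2) * (k + 2) + (d + 1) := by nlinarith
      _ ≤ n k := Nat.lt_two_pow_self.le
  · have hrate : ∀ k, idRate (n k) (2 ^ 2 ^ (e * (k + 2))) =
        (e : ℝ) / (2 * (r + 2) + (d + 1) / ((k + 2 : ℕ) : ℝ)) := by
      intro k
      have h2 : ∀ j : ℕ, Real.logb 2 ((2 : ℝ) ^ j) = j := fun j => by
        rw [Real.logb_pow, Real.logb_self_eq_one one_lt_two, mul_one]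
      simp only [idRate, n, Nat.cast_pow, Nat.cast_ofNat, h2]
      push_cast
      field_simp
    simp only [hrate]
    have heR : (d : ℝ) * (r + 1) - 1 = e := by
      have : (d : ℝ) * (r + 1) = e + 1 := by exact_mod_cast he
      linarith
    rw [heR]
    have hden : Tendsto (fun k : ℕ => 2 * ((r : ℝ) + 2) + ((d : ℝ) + 1) / ((k + 2 : ℕ) : ℝ))
        atTop (𝓝 (2 * (r + 2) + 0)) :=
      ((tendsto_const_div_atTop_nhds_zero_nat _).comp hshift).const_add _
    rw [add_zero] at hden
    exact tendsto_const_nhds.div hden (by positivity)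
  · refine squeeze_zero
      (fun k => (C k).error_nonneg (noisyPermutationChannel_nonneg hU)) herr ?_
    have hη : ∀ k : ℕ, K * n k / ((2 ^ ((r + 3) * (k + 2) + 1) : ℕ) : ℝ) ^ 2 =
        K * 2 ^ d / 2 * (1 / 4) ^ (k + 2) := by
      intro k
      simp only [n]
      push_cast
      rw [one_div, inv_pow, div_eq_iff (by positivity)]
      have h4 : (4 : ℝ) ^ (k + 2) = 2 ^ (2 * (k + 2)) := by
        rw [pow_mul]; norm_num
      rw [h4, ← pow_mul]
      have : ((r + 3) * (k + 2) + 1) * 2 = 2 * (r + 2) * (k + 2) + 2 * (k + 2) + 2 := by ring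
      rw [this, pow_add _ _ 2, pow_add _ _ (2 * (k + 2)), pow_add _ _ (d + 1)]
      field_simp
      ring
    simp only [hη]
    have h1 : Tendsto (fun k : ℕ => K * 2 ^ d / 2 * (1 / 4 : ℝ) ^ (k + 2)) atTop (𝓝 0) := by
      simpa using ((tendsto_pow_atTop_nhds_zero_of_lt_one (by norm_num : (0 : ℝ) ≤ 1 / 4)
        (by norm_num)).comp hshift).const_mul (K * 2 ^ d / 2)
    have h2 : Tendsto (fun k : ℕ => 2 / ((k + 2 : ℕ) : ℝ)) atTop (𝓝 0) :=
      (tendsto_const_div_atTop_nhds_zero_nat 2).comp hshift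
    simpa using (h1.const_mul 2).add h2

lemma exists_isAchievableIDRateDetDecoders_gt (hd : 0 < d) (hU : ∀ a b, 0 ≤ U a b)
    (hU1 : ∀ a, ∑ b, U a b = 1) (hUdet : IsUnit U.det) {b : ℝ} (hb : b < d / 2) :
    ∃ R, IsAchievableIDRateDetDecoders U R ∧ b < R := by
  -- The grid rate equals `d/2 - (d+1) / (2(r+2))`, which tends to `d/2`.
  have hlim : Tendsto (fun r : ℕ => (d : ℝ) / 2 - ((d : ℝ) + 1) / 2 / ((r + 2 : ℕ) : ℝ))
      atTop (𝓝 (d / 2 - 0)) :=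
    ((tendsto_const_div_atTop_nhds_zero_nat _).comp (tendsto_add_atTop_nat 2)).const_sub _
  rw [sub_zero] at hlim
  obtain ⟨r, hr⟩ := (hlim.eventually (lt_mem_nhds hb)).exists
  refine ⟨_, isAchievableIDRateDetDecoders_of_grid hd hU hU1 hUdet r, hr.trans_eq ?_⟩
  push_cast
  field_simp
  ring

end Achievability

lemma isUnit_det_of_rank_eq {q : ℕ} {U : Matrix (Fin q) (Fin q) ℝ} (h : U.rank = q) :
    IsUnit U.det := by
  rw [← Matrix.isUnit_iff_isUnit_det, ← Matrix.mulVec_surjective_iff_isUnit]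
  have htop : LinearMap.range U.mulVecLin = ⊤ := by
    apply Submodule.eq_top_of_finrank_eq
    rw [Module.finrank_fintype_fun_eq_card, Fintype.card_fin]
    exact h
  exact LinearMap.range_eq_top.1 htop

end NoisyPermutation

end

theorem corollary1 (q : ℕ) (hq : 2 ≤ q) (U : Matrix (Fin q) (Fin q) ℝ)
    (hU_stochastic : U ∈ Matrix.rowStochastic ℝ (Fin q))
    (hU_pos : ∀ a b, 0 < U a b)
    (hU_rank : U.rank = q) :
    NoisyPermutation.IsIDCapacity U (((q : ℝ) - 1) / 2) ∧
      NoisyPermutation.IsIDCapacityDetDecoders U (((q : ℝ) - 1) / 2) := by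
  obtain ⟨d, rfl⟩ : ∃ d, q = d + 1 := ⟨q - 1, by omega⟩
  have hU1 : ∀ a, ∑ b, U a b = 1 := Matrix.sum_row_of_mem_rowStochastic hU_stochastic
  have hd : ((d + 1 : ℕ) : ℝ) - 1 = d := by push_cast; ring
  rw [hd]
  have hlow : ∀ b : ℝ, b < d / 2 →
      ∃ R, NoisyPermutation.IsAchievableIDRateDetDecoders U R ∧ b < R := fun b hb =>
    NoisyPermutation.exists_isAchievableIDRateDetDecoders_gt (by omega)
      (fun a b => (hU_pos a b).le) hU1 (NoisyPermutation.isUnit_det_of_rank_eq hU_rank) hb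
  refine ⟨⟨fun R hR => hR.le hU_pos hU1, fun B hB => le_of_not_gt fun hlt => ?_⟩,
    ⟨fun R hR => hR.isAchievableIDRate.le hU_pos hU1, fun B hB => le_of_not_gt fun hlt => ?_⟩⟩
  · obtain ⟨R, hR, hBR⟩ := hlow B hlt
    exact absurd (hB hR.isAchievableIDRate) (not_le.2 hBR)
  · obtain ⟨R, hR, hBR⟩ := hlow B hlt
    exact absurd (hB hR) (not_le.2 hBR)
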